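/- Let $X$ be a real topological vector space that is point separable by its continuous dual $X^*$, the space of continuous linear functionals $h : X \to \mathbb{R}$; that is, for every $x \in X$, if $h(x) = 0$ for all $h \in X^*$, then $x = 0$. Let $C$ be a nonempty compact convex subset of $X$. Then every continuous mapping $f : C \to C$ has a fixed point. -/

import Mathlib

/-! Since functionals separate points, a fixed point is an `x` lying in all the closed sets {h (f x)
= h x}; by compactness of `C` finitely many functionals suffice. For these, `C` is covered by
finitely many small balls of the seminorm ∑ |h|. A partition of unity turns `f` into a self-map of a
simplex, whose Brouwer fixed point gives ∑ |h (f x) - h x| ≤ ε; minimising over `C` gives 0.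

Brouwer's theorem comes from Scarf's lemma (`IsSlack.exists_rainbow`), a parity count over dominant
sets that needs no triangulation, applied to the coordinate orderings of grid points. -/

/-- A finite set `S` is dominant for the orderings given by `e` if no element lies strictly above
the minimum of `S` in every ordering. -/
def IsDominant {T I : Type*} (e : I → T → ℕ) (S : Finset T) : Prop :=
  ∀ y, ∃ i, ∀ x ∈ S, e i y ≤ e i x

theorem IsDominant.mono {T I : Type*} {e : I → T → ℕ} {S S' : Finset T} (h : IsDominant e S)
    (hS : S' ⊆ S) : IsDominant e S' := fun y =>
  let ⟨i, hi⟩ := h y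
  ⟨i, fun x hx => hi x (hS hx)⟩

/-- `y` can be added to `S` in direction `k`: it lies above the minima `m i` of `S` in all orderings
`i ≠ k`, and is `k`-maximal among such elements. -/
def IsExtension {T I : Type*} (e : I → T → ℕ) (m : I → T) (k : I) (y : T) : Prop :=
  (∀ i, i ≠ k → e i (m i) < e i y) ∧
    ∀ z, (∀ i, i ≠ k → e i (m i) < e i z) → e k z ≤ e k y

/-! ### Extensions of dominant sets of corank one -/

section Dominant

variable {T I : Type*} {e : I → T → ℕ} {τ : Finset T} {m : I → T}

theorem IsExtension.exists_of_above [Finite T] {k : I} {w : T} (hw : ∀ i, i ≠ k → e i (m i) < e i w) :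
    ∃ y, IsExtension e m k y := by
  classical
  have := Fintype.ofFinite T
  obtain ⟨y, hy, hmax⟩ := Finset.exists_max_image
    (Finset.univ.filter fun y => ∀ i, i ≠ k → e i (m i) < e i y) (e k) ⟨w, by simpa using hw⟩
  refine ⟨y, by simpa using hy, fun z hz => hmax z (by simpa using hz)⟩

theorem IsExtension.unique (he : ∀ i, Function.Injective (e i)) {k : I} {y z : T}
    (hy : IsExtension e m k y) (hz : IsExtension e m k z) : y = z :=
  he k (le_antisymm (hz.2 y hy.1) (hy.2 z hz.1))

/-- A point above all `m i` with `i ≠ k` can only be bounded in ordering `k`, where `y` is maximal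
among such points; any other point is below some `m i`, hence below all of `insert y τ` there. -/
theorem IsExtension.isDominant_insert [DecidableEq T] {k : I} {y : T} (hτ : IsDominant e τ)
    (hmem : ∀ i, m i ∈ τ) (hmin : ∀ i, ∀ x ∈ τ, e i (m i) ≤ e i x)
    (hk : ∀ x ∈ τ, ∃ i, i ≠ k ∧ m i = x) (hy : IsExtension e m k y) :
    y ∉ τ ∧ IsDominant e (insert y τ) := by
  refine ⟨fun h => ?_, fun z => ?_⟩
  · obtain ⟨i, hi, rfl⟩ := hk y h
    exact lt_irrefl _ (hy.1 i hi)
  · by_cases hz : ∀ i, i ≠ k → e i (m i) < e i z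
    · obtain ⟨i, hi⟩ := hτ z
      have hik : i = k := by
        by_contra h
        exact absurd (hi _ (hmem i)) (not_le.2 (hz i h))
      subst hik
      refine ⟨i, fun x hx => ?_⟩
      rcases Finset.mem_insert.1 hx with rfl | hx
      · exact hy.2 z hz
      · exact hi x hx
    · push Not at hz
      obtain ⟨i, hik, hi⟩ := hz
      refine ⟨i, fun x hx => ?_⟩
      rcases Finset.mem_insert.1 hx with rfl | hx
      · exact hi.trans (hy.1 i hik).le
      · exact hi.trans (hmin i x hx)

theorem injOn_of_surj_of_card [DecidableEq T] [Fintype I] (hmem : ∀ i, m i ∈ τ)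
    (hcard : τ.card + 1 = Fintype.card I) {k : I}
    (hk : ∀ x ∈ τ, ∃ i, i ≠ k ∧ m i = x) :
    ∀ i j, i ≠ k → j ≠ k → m i = m j → i = j := by
  classical
  have himg : (Finset.univ.erase k).image m = τ := by
    ext x
    simp only [Finset.mem_image, Finset.mem_erase, Finset.mem_univ, and_true]
    exact ⟨fun ⟨i, _, h⟩ => h ▸ hmem i, fun h => hk x h⟩
  have hinj : Set.InjOn m (Finset.univ.erase k : Finset I) := by
    rw [← Finset.card_image_iff, himg, Finset.card_erase_of_mem (Finset.mem_univ k),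
      Finset.card_univ]
    omega
  intro i j hi hj h
  exact hinj (by simpa using hi) (by simpa using hj) h

/-- Converse of `IsExtension.isDominant_insert`: `k` is an ordering in which `y` is the minimum of
the enlarged set, so the elements of `τ` must be minima in the other orderings. -/
theorem exists_isExtension_of_isDominant_insert [DecidableEq T] [Fintype I]
    (he : ∀ i, Function.Injective (e i))
    (hmem : ∀ i, m i ∈ τ) (hmin : ∀ i, ∀ x ∈ τ, e i (m i) ≤ e i x)
    (hcard : τ.card + 1 = Fintype.card I) {y : T} (hyτ : y ∉ τ)
    (hy : IsDominant e (insert y τ)) :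
    ∃ k, (∀ x ∈ τ, ∃ i, i ≠ k ∧ m i = x) ∧ IsExtension e m k y := by
  obtain ⟨k, hk⟩ := hy y
  have key : ∀ x ∈ τ, ∃ i, i ≠ k ∧ m i = x ∧ e i x ≤ e i y := by
    intro x hx
    obtain ⟨i, hi⟩ := hy x
    have hiy := hi y (Finset.mem_insert_self _ _)
    refine ⟨i, ?_, he i (le_antisymm (hmin i x hx) (hi _ (Finset.mem_insert_of_mem (hmem i)))), hiy⟩
    rintro rfl
    exact hyτ (he i (le_antisymm hiy (hk x (Finset.mem_insert_of_mem hx))) ▸ hx)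
  have hsurj : ∀ x ∈ τ, ∃ i, i ≠ k ∧ m i = x := fun x hx =>
    let ⟨i, h1, h2, _⟩ := key x hx
    ⟨i, h1, h2⟩
  refine ⟨k, hsurj, fun i hik => ?_, fun z hz => ?_⟩
  · obtain ⟨j, hjk, hj, hle⟩ := key (m i) (hmem i)
    obtain rfl := injOn_of_surj_of_card hmem hcard hsurj j i hjk hik hj
    refine lt_of_le_of_ne hle fun h => hyτ ?_
    rw [← he _ h]
    exact hmem _
  · obtain ⟨i, hi⟩ := hy z
    by_cases hik : i = k
    · subst hik
      exact hi y (Finset.mem_insert_self _ _)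
    · exact absurd (hi _ (Finset.mem_insert_of_mem (hmem i))) (not_le.2 (hz i hik))

/-- A dominant set of corank one with enough elements above it extends in exactly two ways to a
dominant set of full rank. -/
theorem IsDominant.exists_two_extensions [Finite T] [DecidableEq T] [Fintype I]
    (he : ∀ i, Function.Injective (e i))
    (hτ : IsDominant e τ) (hne : τ.Nonempty) (hcard : τ.card + 1 = Fintype.card I)
    (habove : ∀ k, ∃ w, ∀ i, i ≠ k → ∃ x ∈ τ, e i x < e i w) :
    ∃ y₁ y₂, y₁ ≠ y₂ ∧ ∀ y, (y ∉ τ ∧ IsDominant e (insert y τ)) ↔ y = y₁ ∨ y = y₂ := by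
  choose m hmem hmin using fun i => Finset.exists_min_image τ (e i) hne
  have hsurj : ∀ x ∈ τ, ∃ i, m i = x := fun x hx => by
    obtain ⟨i, hi⟩ := hτ x
    exact ⟨i, he i (le_antisymm (hmin i x hx) (hi _ (hmem i)))⟩
  -- Every element of `τ` is a minimum, and there is one more ordering than elements, so exactly one
  -- pair of orderings shares its minimum. Only these two can be the direction of an extension.
  obtain ⟨a, -, b, -, hab, hmab⟩ := Finset.exists_ne_map_eq_of_card_lt_of_maps_to
    (s := (Finset.univ : Finset I)) (t := τ) (f := m)
    (by rw [Finset.card_univ]; omega) (fun i _ => hmem i)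
  have hsa : ∀ x ∈ τ, ∃ i, i ≠ a ∧ m i = x := fun x hx => by
    obtain ⟨i, hi⟩ := hsurj x hx
    by_cases h : i = a
    · exact ⟨b, hab.symm, by rw [← hmab, ← h, hi]⟩
    · exact ⟨i, h, hi⟩
  have hsb : ∀ x ∈ τ, ∃ i, i ≠ b ∧ m i = x := fun x hx => by
    obtain ⟨i, hi⟩ := hsurj x hx
    by_cases h : i = b
    · exact ⟨a, hab, by rw [hmab, ← h, hi]⟩
    · exact ⟨i, h, hi⟩
  have hex : ∀ k, ∃ y, IsExtension e m k y := fun k => by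
    obtain ⟨w, hw⟩ := habove k
    refine IsExtension.exists_of_above (w := w) fun i hi => ?_
    obtain ⟨x, hx, hlt⟩ := hw i hi
    exact (hmin i x hx).trans_lt hlt
  obtain ⟨y₁, h₁⟩ := hex a
  obtain ⟨y₂, h₂⟩ := hex b
  refine ⟨y₁, y₂, ?_, fun y => ⟨?_, ?_⟩⟩
  -- A common extension would exceed every `m i`, against dominance of `τ`.
  · rintro rfl
    obtain ⟨i, hi⟩ := hτ y₁
    refine absurd (hi _ (hmem i)) (not_le.2 ?_)
    by_cases h : i = a
    · exact h₂.1 i (h ▸ hab)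
    · exact h₁.1 i h
  · rintro ⟨hyτ, hy⟩
    obtain ⟨k, hk, hky⟩ := exists_isExtension_of_isDominant_insert he hmem hmin hcard hyτ hy
    by_cases hka : k = a
    · subst hka
      exact Or.inl (hky.unique he h₁)
    by_cases hkb : k = b
    · subst hkb
      exact Or.inr (hky.unique he h₂)
    exfalso
    obtain ⟨i, hik, hi⟩ := hk _ (hmem k)
    by_cases hia : i = a
    · exact hik (injOn_of_surj_of_card hmem hcard hsb i k (hia ▸ hab) hkb hi)
    · exact hik (injOn_of_surj_of_card hmem hcard hsa i k hia hka hi)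
  · rintro (rfl | rfl)
    · exact h₁.isDominant_insert hτ hmem hmin hsa
    · exact h₂.isDominant_insert hτ hmem hmin hsb

end Dominant

/-! ### Scarf's lemma by parity -/

/-- The elements `s i` are slack elements for the orderings `e`: `s i` is the least element of the
`i`-th ordering, and in that ordering all other slack elements lie above all non-slack elements. -/
structure IsSlack {T I : Type*} (e : I → T → ℕ) (s : I → T) : Prop where
  lt_of_ne : ∀ i y, y ≠ s i → e i (s i) < e i y
  lt_slack : ∀ i j y, j ≠ i → y ∉ Set.range s → e i y < e i (s j)

section Scarf

variable {T I : Type*} [DecidableEq T] [Fintype I] [DecidableEq I]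
  {e : I → T → ℕ} {s : I → T} {c : T → I}

/-- The boundary door: `w` is the `i₀`-largest non-slack element. It exceeds `s j` in each ordering
`j ≠ i₀`, so an extension must bound it in ordering `i₀`. -/
theorem IsSlack.exists_extension_iff [Fintype T] (he : ∀ i, Function.Injective (e i))
    (hs : IsSlack e s) (hreal : ∃ y, y ∉ Set.range s) (i₀ : I) :
    ∃ w, ∀ y, (y ∉ (Finset.univ.erase i₀).image s ∧
      IsDominant e (insert y ((Finset.univ.erase i₀).image s))) ↔ y = w := by
  classical
  obtain ⟨w, hw, hmax⟩ := Finset.exists_max_image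
    (Finset.univ.filter fun y => y ∉ Set.range s) (e i₀) (by
      obtain ⟨y, hy⟩ := hreal
      exact ⟨y, by simpa using hy⟩)
  replace hw : w ∉ Set.range s := (Finset.mem_filter.1 hw).2
  replace hmax : ∀ y, y ∉ Set.range s → e i₀ y ≤ e i₀ w := fun y hy =>
    hmax y (Finset.mem_filter.2 ⟨Finset.mem_univ _, hy⟩)
  have hmem : ∀ j, j ≠ i₀ → s j ∈ (Finset.univ.erase i₀).image s := fun j hj =>
    Finset.mem_image_of_mem _ (by simpa using hj)
  refine ⟨w, fun y => ⟨?_, ?_⟩⟩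
  · rintro ⟨hy, hdom⟩
    obtain ⟨i, hi⟩ := hdom w
    have hi0 : i = i₀ := by
      by_contra h
      exact absurd (hi _ (Finset.mem_insert_of_mem (hmem i h)))
        (not_le.2 (hs.lt_of_ne i w fun h => hw ⟨i, h.symm⟩))
    subst hi0
    have hiy := hi y (Finset.mem_insert_self _ _)
    by_cases hyr : y ∈ Set.range s
    · obtain ⟨j, rfl⟩ := hyr
      by_cases hj : j = i
      · subst hj
        exact absurd hiy (not_le.2 (hs.lt_of_ne j w fun h => hw ⟨j, h.symm⟩))
      · exact absurd (hmem j hj) hy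
    · exact he i (le_antisymm (hmax y hyr) hiy)
  · rintro rfl
    refine ⟨fun h => ?_, fun z => ?_⟩
    · obtain ⟨j, -, hj⟩ := Finset.mem_image.1 h
      exact hw ⟨j, hj⟩
    · by_cases hz : z ∈ Set.range s
      · obtain ⟨j, rfl⟩ := hz
        refine ⟨j, fun x _ => ?_⟩
        by_cases hx : x = s j
        · rw [hx]
        · exact (hs.lt_of_ne j x hx).le
      · refine ⟨i₀, fun x hx => ?_⟩
        rcases Finset.mem_insert.1 hx with rfl | hx
        · exact hmax z hz
        · obtain ⟨j, hj, rfl⟩ := Finset.mem_image.1 hx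
          exact (hs.lt_slack i₀ j z (Finset.ne_of_mem_erase hj) hz).le

theorem IsSlack.even_card_extensions {T I : Type*} [DecidableEq T] [Fintype I]
    {e : I → T → ℕ} {s : I → T} [Fintype T] (he : ∀ i, Function.Injective (e i))
    (hs : IsSlack e s)
    {τ : Finset T} (hcard : τ.card + 1 = Fintype.card I) (hτ : ∃ t ∈ τ, t ∉ Set.range s)
    [DecidablePred fun y => y ∉ τ ∧ IsDominant e (insert y τ)] :
    Even (Finset.univ.filter fun y => y ∉ τ ∧ IsDominant e (insert y τ)).card := by
  obtain ⟨t, ht, htr⟩ := hτ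
  by_cases hdom : IsDominant e τ
  · obtain ⟨y₁, y₂, hne, h⟩ := hdom.exists_two_extensions he ⟨t, ht⟩ hcard
      fun k => ⟨s k, fun i hi => ⟨t, ht, hs.lt_slack i k t hi.symm htr⟩⟩
    have : (Finset.univ.filter fun y => y ∉ τ ∧ IsDominant e (insert y τ)) = {y₁, y₂} := by
      ext y
      simp [h]
    rw [this, Finset.card_pair hne]
    exact even_two
  · rw [Finset.card_eq_zero.2]
    · exact Even.zero
    · refine Finset.filter_eq_empty_iff.2 fun y _ hy => hdom ?_
      exact hy.2.mono (Finset.subset_insert _ _)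

/-- If deleting `x` leaves each colour but `i₀` exactly once, then `c x` repeats the colour of a
unique `x'`, and only `x` and `x'` can be deleted. -/
theorem even_card_facets_of_not_rainbow {S : Finset T} (hcard : S.card = Fintype.card I) (i₀ : I)
    (hS : S.image c ≠ Finset.univ) :
    Even (S.filter fun x => (S.erase x).image c = Finset.univ.erase i₀).card := by
  rcases (S.filter fun x => (S.erase x).image c = Finset.univ.erase i₀).eq_empty_or_nonempty
    with h | ⟨x, hx⟩
  · rw [h]
    exact Even.zero
  obtain ⟨hxS, hx⟩ := Finset.mem_filter.1 hx
  have hins : S.image c = insert (c x) (Finset.univ.erase i₀) := by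
    rw [← hx, ← Finset.image_insert, Finset.insert_erase hxS]
  have hcx : c x ≠ i₀ := by
    intro h
    rw [h, Finset.insert_erase (Finset.mem_univ _)] at hins
    exact hS hins
  have hinj : Set.InjOn c (S.erase x : Finset T) := by
    rw [← Finset.card_image_iff, hx, Finset.card_erase_of_mem (Finset.mem_univ _),
      Finset.card_erase_of_mem hxS, hcard, Finset.card_univ]
  obtain ⟨x', hx', hcx'⟩ := Finset.mem_image.1
    (show c x ∈ (S.erase x).image c by rw [hx]; simpa using hcx)
  have hx'S := Finset.mem_of_mem_erase hx'
  have hne : x' ≠ x := Finset.ne_of_mem_erase hx'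
  have : (S.filter fun x => (S.erase x).image c = Finset.univ.erase i₀) = {x, x'} := by
    ext z
    simp only [Finset.mem_filter, Finset.mem_insert, Finset.mem_singleton]
    constructor
    · rintro ⟨hzS, hz⟩
      by_contra! hzx
      have hcz : c z ∈ (S.erase z).image c := by
        rw [hz, ← hx]
        exact Finset.mem_image_of_mem _ (Finset.mem_erase.2 ⟨hzx.1, hzS⟩)
      obtain ⟨z', hz', hcz'⟩ := Finset.mem_image.1 hcz
      obtain ⟨hzz', hz'S⟩ := Finset.mem_erase.1 hz'
      have hz'x : z' = x := by
        by_contra h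
        exact hzz' (hinj (by simp [h, hz'S]) (by simp [hzx.1, hzS]) hcz')
      subst hz'x
      exact hzx.2 (hinj (by simp [hzx.1, hzS]) (by simp [hne, hx'S]) (hcz'.symm.trans hcx'.symm))
    · rintro (rfl | rfl)
      · exact ⟨hxS, hx⟩
      · refine ⟨hx'S, ?_⟩
        rw [← hx]
        ext i
        simp only [Finset.mem_image, Finset.mem_erase]
        constructor
        · rintro ⟨u, ⟨hu, huS⟩, rfl⟩
          by_cases hux : u = x
          · exact ⟨z, ⟨hne, hx'S⟩, by rw [hcx', hux]⟩
          · exact ⟨u, ⟨hux, huS⟩, rfl⟩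
        · rintro ⟨u, ⟨hu, huS⟩, rfl⟩
          by_cases hux : u = z
          · exact ⟨x, ⟨hne.symm, hxS⟩, by rw [hux, hcx']⟩
          · exact ⟨u, ⟨hux, huS⟩, rfl⟩
  rw [this, Finset.card_pair hne.symm]
  exact even_two

/-- **Scarf's lemma**: there is a dominant set on which the colouring takes every value. -/
theorem IsSlack.exists_rainbow [Fintype T] [Nonempty I] (he : ∀ i, Function.Injective (e i))
    (hs : IsSlack e s) (hc : ∀ i, c (s i) = i) (hreal : ∃ y, y ∉ Set.range s) :
    ∃ S : Finset T, IsDominant e S ∧ S.image c = Finset.univ := by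
  classical
  obtain ⟨i₀⟩ := ‹Nonempty I›
  have hinj : Function.Injective s := Function.LeftInverse.injective hc
  by_contra! hno
  set doors : Finset (Finset T) := Finset.univ.filter fun τ =>
    τ.card + 1 = Fintype.card I ∧ τ.image c = Finset.univ.erase i₀ with hdoors
  set rooms : Finset (Finset T) := Finset.univ.filter fun S =>
    S.card = Fintype.card I ∧ IsDominant e S with hrooms
  -- Incidences between doors and rooms, counted from both sides.
  have hcount : ∑ τ ∈ doors, (Finset.univ.filter fun y =>
        y ∉ τ ∧ IsDominant e (insert y τ)).card =
      ∑ S ∈ rooms, (S.filter fun x => (S.erase x).image c = Finset.univ.erase i₀).card := by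
    rw [← Finset.card_sigma, ← Finset.card_sigma]
    refine Finset.card_nbij' (fun p => ⟨insert p.2 p.1, p.2⟩) (fun p => ⟨p.1.erase p.2, p.2⟩)
      ?_ ?_ ?_ ?_
    · rintro ⟨τ, y⟩ h
      simp only [hdoors, hrooms, Finset.coe_sigma, Set.mem_sigma_iff, Finset.mem_coe,
        Finset.mem_filter, Finset.mem_univ, true_and, Finset.mem_insert_self] at h ⊢
      obtain ⟨⟨h1, h2⟩, h3, h4⟩ := h
      rw [Finset.card_insert_of_notMem h3, Finset.erase_insert h3]
      exact ⟨⟨h1, h4⟩, h2⟩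
    · rintro ⟨S, x⟩ h
      simp only [hdoors, hrooms, Finset.coe_sigma, Set.mem_sigma_iff, Finset.mem_coe,
        Finset.mem_filter, Finset.mem_univ, true_and] at h ⊢
      obtain ⟨⟨h1, h2⟩, h3, h4⟩ := h
      rw [Finset.insert_erase h3, Finset.card_erase_add_one h3]
      exact ⟨⟨h1, h4⟩, Finset.notMem_erase _ _, h2⟩
    · rintro ⟨τ, y⟩ h
      simp only [Finset.coe_sigma, Set.mem_sigma_iff, Finset.mem_coe, Finset.mem_filter] at h
      simp [Finset.erase_insert h.2.2.1]
    · rintro ⟨S, x⟩ h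
      simp only [Finset.coe_sigma, Set.mem_sigma_iff, Finset.mem_coe, Finset.mem_filter] at h
      simp [Finset.insert_erase h.2.1]
  have hright : Even (∑ S ∈ rooms,
      (S.filter fun x => (S.erase x).image c = Finset.univ.erase i₀).card) := by
    refine Finset.even_sum _ fun S hS => ?_
    obtain ⟨h1, h2⟩ := (Finset.mem_filter.1 hS).2
    exact even_card_facets_of_not_rainbow h1 i₀ (hno S h2)
  set τ₀ : Finset T := (Finset.univ.erase i₀).image s with hτ₀
  have hτ₀mem : τ₀ ∈ doors := by
    refine Finset.mem_filter.2 ⟨Finset.mem_univ _, ?_, ?_⟩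
    · rw [hτ₀, Finset.card_image_of_injective _ hinj,
        Finset.card_erase_add_one (Finset.mem_univ _), Finset.card_univ]
    · rw [hτ₀, Finset.image_image, show c ∘ s = id from funext hc, Finset.image_id]
  obtain ⟨w, hw⟩ := hs.exists_extension_iff he hreal i₀
  have hone : (Finset.univ.filter fun y => y ∉ τ₀ ∧ IsDominant e (insert y τ₀)).card = 1 := by
    rw [Finset.card_eq_one]
    exact ⟨w, by ext y; simp [hτ₀, -Finset.mem_image, hw]⟩
  rw [← hcount, ← Finset.add_sum_erase _ _ hτ₀mem, hone] at hright
  have hrest : Even (∑ τ ∈ doors.erase τ₀,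
      (Finset.univ.filter fun y => y ∉ τ ∧ IsDominant e (insert y τ)).card) := by
    refine Finset.even_sum _ fun τ hτ => ?_
    obtain ⟨hne, hτ⟩ := Finset.mem_erase.1 hτ
    obtain ⟨h1, h2⟩ := (Finset.mem_filter.1 hτ).2
    refine hs.even_card_extensions he h1 ?_
    -- A door made of slack elements only is determined by its colours, so it is `τ₀`.
    by_contra! hall
    refine hne (Finset.Subset.antisymm (fun x hx => ?_) fun x hx => ?_)
    · obtain ⟨j, rfl⟩ := hall x hx
      have := Finset.mem_image_of_mem c hx
      rw [h2, hc] at this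
      exact Finset.mem_image_of_mem _ this
    · obtain ⟨j, hj, rfl⟩ := Finset.mem_image.1 hx
      rw [← h2] at hj
      obtain ⟨x, hx, hxj⟩ := Finset.mem_image.1 hj
      obtain ⟨k, rfl⟩ := hall x hx
      rw [hc] at hxj
      exact hxj ▸ hx
  exact absurd hright (by rw [Nat.not_even_iff_odd]; exact odd_one.add_even hrest)

end Scarf

/-! ### Grid points of the simplex -/

section Grid

variable {I : Type*} [Fintype I] [DecidableEq I]

/-- The `m i` over `C` fall short of `N` by less than `C.card`, so this bounds the total excess of
`x` over them. -/
theorem lt_add_card_of_sum_lt {N : ℕ} {C : Finset I} {m x : I → ℕ} (hx : ∑ i, x i = N)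
    (hm : ∀ i, m i ≤ x i) (hN : N < ∑ i ∈ C, (m i + 1)) (j : I) :
    x j < (if j ∈ C then m j else 0) + Fintype.card I := by
  have hC : C.card ≤ Fintype.card I := C.card_le_univ
  have hsum : ∑ i ∈ C, (m i + 1) = ∑ i ∈ C, m i + C.card := by
    rw [Finset.sum_add_distrib, Finset.sum_const, smul_eq_mul, mul_one]
  split_ifs with hj
  · have h1 : ∑ i ∈ C, x i ≤ ∑ i, x i :=
      Finset.sum_le_sum_of_subset (Finset.subset_univ C)
    have h2 : ∑ i ∈ C.erase j, m i ≤ ∑ i ∈ C.erase j, x i := Finset.sum_le_sum fun i _ => hm i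
    rw [← Finset.add_sum_erase _ _ hj] at h1
    rw [hsum, ← Finset.add_sum_erase _ _ hj] at hN
    omega
  · have h1 : ∑ i ∈ insert j C, x i ≤ ∑ i, x i :=
      Finset.sum_le_sum_of_subset (Finset.subset_univ _)
    have h2 : ∑ i ∈ C, m i ≤ ∑ i ∈ C, x i := Finset.sum_le_sum fun i _ => hm i
    rw [Finset.sum_insert hj] at h1
    omega

/-- If no grid point exceeds `m` on all of `C`, then `m` nearly sums to the size of the grid. -/
theorem lt_sum_of_forall_exists_le {N : ℕ} {C : Finset I} {m : I → ℕ}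
    (h : ∀ y : I → ℕ, ∑ i, y i = N → ∃ i ∈ C, y i ≤ m i) (hC : C.Nonempty) :
    N < ∑ i ∈ C, (m i + 1) := by
  by_contra! hle
  obtain ⟨k, hk⟩ := hC
  -- The point `m + 1` on `C`, with the unused mass placed at `k`.
  obtain ⟨i, hi, hle⟩ := h (fun i => (if i ∈ C then m i + 1 else 0) +
    if i = k then N - ∑ i ∈ C, (m i + 1) else 0) (by
      rw [Finset.sum_add_distrib, Finset.sum_ite_mem, Finset.univ_inter, Finset.sum_ite_eq',
        if_pos (Finset.mem_univ k)]
      omega)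
  rw [if_pos hi] at hle
  omega

/-- The coordinate orderings on the points of a finite set `A` of grid points, with ties broken by
an enumeration `r`, and extended by slack elements with enumeration `u`. -/
def gridRank {A : Finset (I → ℕ)} (r : A ≃ Fin A.card) (u : I ≃ Fin (Fintype.card I)) (N : ℕ)
    (i : I) : A ⊕ I → ℕ
  -- As `r x < A.card`, the coordinate decides before the tie-break; `+ 1` reserves rank 0 for the
  -- slack element of ordering `i`.
  | .inl x => x.1 i * A.card + r x + 1
  | .inr j => if j = i then 0 else (N + 1) * A.card + u j + 1

theorem gridRank_inl_lt {A : Finset (I → ℕ)} (r : A ≃ Fin A.card)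
    (u : I ≃ Fin (Fintype.card I)) {N : ℕ} {i : I} {x : A} (hx : x.1 i ≤ N) :
    gridRank r u N i (.inl x) < (N + 1) * A.card + 1 := by
  have := (r x).2
  simp only [gridRank]
  nlinarith

theorem gridRank_lt_of_lt {A : Finset (I → ℕ)} (r : A ≃ Fin A.card)
    (u : I ≃ Fin (Fintype.card I)) {N : ℕ} {i : I} {x y : A} (hx : x.1 i < y.1 i) :
    gridRank r u N i (.inl x) < gridRank r u N i (.inl y) := by
  have := (r x).2
  simp only [gridRank]
  nlinarith

theorem gridRank_injective {A : Finset (I → ℕ)} (r : A ≃ Fin A.card)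
    (u : I ≃ Fin (Fintype.card I)) {N : ℕ} (hA : ∀ x ∈ A, ∀ i, x i ≤ N) (i : I) :
    Function.Injective (gridRank r u N i) := by
  have hne : ∀ (x : A) j, gridRank r u N i (.inl x) ≠ gridRank r u N i (.inr j) := fun x j h => by
    have := gridRank_inl_lt r u (hA x x.2 i)
    rw [h] at this
    by_cases hj : j = i
    · simp [gridRank, hj] at h
    · simp only [gridRank, if_neg hj] at this
      omega
  rintro (x | j) (y | k) h
  · rcases lt_trichotomy (x.1 i) (y.1 i) with hlt | heq | hlt
    · exact absurd h (gridRank_lt_of_lt r u hlt).ne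
    · simp only [gridRank, heq] at h
      have hxy : x = y := r.injective (Fin.ext (by omega))
      rw [hxy]
    · exact absurd h (gridRank_lt_of_lt r u hlt).ne'
  · exact absurd h (hne x k)
  · exact absurd h.symm (hne y j)
  · by_cases hj : j = i <;> by_cases hk : k = i
    · rw [hj, hk]
    · simp [gridRank, hj, hk] at h
    · simp [gridRank, hj, hk] at h
    · simp only [gridRank, if_neg hj, if_neg hk] at h
      have hjk : j = k := u.injective (Fin.ext (by omega))
      rw [hjk]

theorem isSlack_gridRank {A : Finset (I → ℕ)} (r : A ≃ Fin A.card)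
    (u : I ≃ Fin (Fintype.card I)) {N : ℕ} (hA : ∀ x ∈ A, ∀ i, x i ≤ N) :
    IsSlack (gridRank r u N) Sum.inr where
  lt_of_ne i y hy := by
    rcases y with x | j
    · simp [gridRank]
    · have : j ≠ i := fun h => hy (h ▸ rfl)
      simp [gridRank, this]
  lt_slack i j y hj hy := by
    rcases y with x | k
    · refine (gridRank_inl_lt r u (hA x x.2 i)).trans_le ?_
      simp only [gridRank, if_neg hj]
      omega
    · exact absurd ⟨k, rfl⟩ hy

/-- A discrete form of Brouwer's theorem: for a colouring of the grid points of a simplex, some grid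
point is close, for every colour `i`, to the `i`-th facet or to a point of colour `i`. -/
theorem exists_near_facet_or_color [Nonempty I] (N : ℕ) (c : (I → ℕ) → I) :
    ∃ p : I → ℕ, ∑ i, p i = N ∧ ∀ i, p i < Fintype.card I ∨
      ∃ x : I → ℕ, ∑ i, x i = N ∧ c x = i ∧
        ∀ j, x j < p j + Fintype.card I ∧ p j < x j + Fintype.card I := by
  set A : Finset (I → ℕ) := Finset.piAntidiag Finset.univ N with hAdef
  have hmemA : ∀ x : I → ℕ, x ∈ A ↔ ∑ i, x i = N := fun x => by simp [hAdef]
  have hA : ∀ x ∈ A, ∀ i, x i ≤ N := fun x hx i => by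
    rw [← (hmemA x).1 hx]
    exact Finset.single_le_sum (fun _ _ => Nat.zero_le _) (Finset.mem_univ i)
  obtain ⟨i₀⟩ := ‹Nonempty I›
  have hp : Pi.single i₀ N ∈ A := (hmemA _).2 (by simp)
  set r : A ≃ Fin A.card := A.equivFin
  set u : I ≃ Fin (Fintype.card I) := Fintype.equivFin I
  obtain ⟨S, hdom, hS⟩ := (isSlack_gridRank r u hA).exists_rainbow (gridRank_injective r u hA)
    (c := Sum.elim (fun x => c x.1) id) (fun i => rfl) ⟨.inl ⟨_, hp⟩, by simp⟩
  -- Colours in `C` must be supplied by grid points of `S`; the others lead to the facet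
  -- alternative.
  set C : Finset I := Finset.univ.filter fun i => Sum.inr i ∉ S with hC
  set P : Finset A := Finset.univ.filter fun x => Sum.inl x ∈ S with hP
  have hcol : ∀ i ∈ C, ∃ x ∈ P, c x.1 = i := fun i hi => by
    obtain ⟨x | j, hx, hxi⟩ := Finset.mem_image.1 (hS ▸ Finset.mem_univ i)
    · exact ⟨x, by simpa [hP] using hx, hxi⟩
    · obtain rfl : j = i := hxi
      exact absurd hx (Finset.mem_filter.1 hi).2
  have hdomA : ∀ y : I → ℕ, ∑ i, y i = N → ∃ i ∈ C, ∀ x ∈ P, y i ≤ x.1 i := fun y hy => by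
    obtain ⟨i, hi⟩ := hdom (.inl ⟨y, (hmemA y).2 hy⟩)
    refine ⟨i, Finset.mem_filter.2 ⟨Finset.mem_univ _, fun h => ?_⟩, fun x hx => ?_⟩
    · simpa [gridRank] using hi _ h
    · by_contra! hlt
      exact absurd (hi _ (Finset.mem_filter.1 hx).2)
        (not_le.2 (gridRank_lt_of_lt (y := ⟨y, (hmemA y).2 hy⟩) r u hlt))
  obtain ⟨k, hk, -⟩ := hdomA _ ((hmemA _).1 hp)
  obtain ⟨p, hpP, -⟩ := hcol k hk
  choose q hqP hq using fun i => Finset.exists_min_image P (fun x => x.1 i) ⟨p, hpP⟩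
  have hN : N < ∑ i ∈ C, ((q i).1 i + 1) :=
    lt_sum_of_forall_exists_le (fun y hy =>
      let ⟨i, hi, h⟩ := hdomA y hy
      ⟨i, hi, h _ (hqP i)⟩) ⟨k, hk⟩
  have hclose : ∀ x ∈ P, ∀ j, x.1 j < (if j ∈ C then (q j).1 j else 0) + Fintype.card I :=
    fun x hx => lt_add_card_of_sum_lt ((hmemA _).1 x.2) (fun i => hq i x hx) hN
  have hlow : ∀ x ∈ P, ∀ j, (if j ∈ C then (q j).1 j else 0) ≤ x.1 j := fun x hx j => by
    split_ifs
    · exact hq j x hx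
    · exact Nat.zero_le _
  refine ⟨p.1, (hmemA _).1 p.2, fun i => ?_⟩
  by_cases hi : i ∈ C
  · obtain ⟨x, hx, hxi⟩ := hcol i hi
    refine Or.inr ⟨x.1, (hmemA _).1 x.2, hxi, fun j => ⟨?_, ?_⟩⟩
    · have := hclose x hx j
      have := hlow p hpP j
      omega
    · have := hclose p hpP j
      have := hlow x hx j
      omega
  · have := hclose p hpP i
    rw [if_neg hi, zero_add] at this
    exact Or.inl this

end Grid

/-! ### Brouwer's theorem on the simplex -/

section Brouwer

variable {I : Type*} [Fintype I]

theorem stdSimplex.exists_le (x y : stdSimplex ℝ I) : ∃ i, x.1 i ≤ y.1 i := by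
  by_contra! h
  have hne : (Finset.univ : Finset I).Nonempty := by
    by_contra hemp
    have := x.2.2
    rw [Finset.not_nonempty_iff_eq_empty.1 hemp, Finset.sum_empty] at this
    exact zero_ne_one this
  have := Finset.sum_lt_sum_of_nonempty hne fun i _ => h i
  rw [x.2.2, y.2.2] at this
  exact lt_irrefl _ this

theorem stdSimplex.eq_of_forall_le {x y : stdSimplex ℝ I} (h : ∀ i, x.1 i ≤ y.1 i) : x = y := by
  have := (Finset.sum_eq_sum_iff_of_le fun i _ => h i).1 (x.2.2.trans y.2.2.symm)
  exact Subtype.ext (funext fun i => this i (Finset.mem_univ i))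

theorem div_mem_stdSimplex {N : ℕ} (hN : 0 < N) {k : I → ℕ} (hk : ∑ i, k i = N) :
    (fun i => (k i : ℝ) / N) ∈ stdSimplex ℝ I := by
  refine ⟨fun i => by positivity, ?_⟩
  rw [← Finset.sum_div, ← Nat.cast_sum, hk]
  exact div_self (by positivity)

/-- Colour a grid point by a coordinate that `f` does not decrease. Near facet `i` the coordinate
itself is small; near a point of colour `i` uniform continuity applies. -/
theorem stdSimplex.exists_forall_le_add [Nonempty I] {f : stdSimplex ℝ I → stdSimplex ℝ I}
    (hf : Continuous f) {ε : ℝ} (hε : 0 < ε) :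
    ∃ x : stdSimplex ℝ I, ∀ i, x.1 i ≤ (f x).1 i + ε := by
  classical
  have : CompactSpace (stdSimplex ℝ I) := isCompact_iff_compactSpace.1 (isCompact_stdSimplex ℝ I)
  obtain ⟨δ, hδ, hfδ⟩ := Metric.uniformContinuous_iff.1
    (CompactSpace.uniformContinuous_of_continuous hf) (ε / 2) (half_pos hε)
  have hη : 0 < min δ (ε / 2) := lt_min hδ (half_pos hε)
  obtain ⟨M, hM⟩ := exists_nat_gt ((Fintype.card I : ℝ) / min δ (ε / 2))
  have hM0 : (0 : ℝ) < M := lt_of_le_of_lt (by positivity) hM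
  have hN : 0 < M := by exact_mod_cast hM0
  have hsmall : (Fintype.card I : ℝ) / M < min δ (ε / 2) := by
    rw [div_lt_iff₀ hM0]
    rwa [div_lt_iff₀ hη, mul_comm] at hM
  set pt : (k : I → ℕ) → ∑ i, k i = M → stdSimplex ℝ I := fun k hk =>
    ⟨_, div_mem_stdSimplex hN hk⟩ with hpt
  obtain ⟨p, hp, h⟩ := exists_near_facet_or_color M fun k =>
    if hk : ∑ i, k i = M then (stdSimplex.exists_le (pt k hk) (f (pt k hk))).choose
    else Classical.arbitrary I
  refine ⟨pt p hp, fun i => ?_⟩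
  rcases h i with h | ⟨x, hx, hxi, hxp⟩
  · have h1 : (p i : ℝ) / M < Fintype.card I / M := by
      gcongr
    have h2 := (f (pt p hp)).2.1 i
    have h3 := min_le_right δ (ε / 2)
    change (p i : ℝ) / M ≤ _
    linarith
  · rw [dif_pos hx] at hxi
    have hle := (stdSimplex.exists_le (pt x hx) (f (pt x hx))).choose_spec
    rw [hxi] at hle
    have hdist : ∀ j, |(x j : ℝ) / M - p j / M| < min δ (ε / 2) := fun j => by
      refine lt_of_le_of_lt ?_ hsmall
      rw [← sub_div, abs_div, abs_of_pos hM0]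
      gcongr
      rw [abs_le]
      have h1 : (x j : ℝ) < p j + Fintype.card I := by exact_mod_cast (hxp j).1
      have h2 : (p j : ℝ) < x j + Fintype.card I := by exact_mod_cast (hxp j).2
      constructor <;> linarith
    have hd : dist (pt x hx) (pt p hp) < δ := by
      rw [Subtype.dist_eq, dist_pi_lt_iff hδ]
      exact fun j => (hdist j).trans_le (min_le_left _ _)
    have h1 := (dist_pi_lt_iff (half_pos hε)).1 (hfδ hd) i
    rw [Real.dist_eq, abs_lt] at h1
    have h2 := abs_lt.1 ((hdist i).trans_le (min_le_right _ _))
    change (p i : ℝ) / M ≤ _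
    change (x i : ℝ) / M ≤ _ at hle
    linarith [h1.2, h2.1]

/-- **Brouwer's fixed point theorem** for the standard simplex. -/
theorem stdSimplex.exists_fixedPoint [Nonempty I] {f : stdSimplex ℝ I → stdSimplex ℝ I}
    (hf : Continuous f) : ∃ x, f x = x := by
  have : CompactSpace (stdSimplex ℝ I) := isCompact_iff_compactSpace.1 (isCompact_stdSimplex ℝ I)
  obtain ⟨x₀, -⟩ := stdSimplex.exists_forall_le_add hf one_pos
  -- The minimum of `g` is 0 by the approximate solutions; at a minimiser no coordinate decreases,
  -- and equal sums force equality.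
  set g : stdSimplex ℝ I → ℝ := fun x => ∑ i, max 0 (x.1 i - (f x).1 i) with hg
  have hgc : Continuous g := by
    have h1 : ∀ i, Continuous fun x : stdSimplex ℝ I => x.1 i := fun i =>
      (continuous_apply i).comp continuous_subtype_val
    exact continuous_finsetSum _ fun i _ => continuous_const.max ((h1 i).sub ((h1 i).comp hf))
  obtain ⟨x, -, hx⟩ := isCompact_univ.exists_isMinOn ⟨x₀, Set.mem_univ _⟩ hgc.continuousOn
  have hcard : (0 : ℝ) < Fintype.card I := by exact_mod_cast Fintype.card_pos
  have hx0 : g x ≤ 0 := by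
    refine le_of_forall_pos_le_add fun ε hε => ?_
    obtain ⟨y, hy⟩ := stdSimplex.exists_forall_le_add hf (div_pos hε hcard)
    calc g x ≤ g y := hx (Set.mem_univ y)
      _ ≤ ∑ _i : I, ε / Fintype.card I := Finset.sum_le_sum fun i _ =>
        max_le (by positivity) (by linarith [hy i])
      _ = 0 + ε := by
        rw [Finset.sum_const, Finset.card_univ, nsmul_eq_mul, zero_add]
        field_simp
  refine ⟨x, (stdSimplex.eq_of_forall_le fun i => ?_).symm⟩
  have h1 := Finset.single_le_sum (f := fun i => max 0 (x.1 i - (f x).1 i))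
    (fun i _ => le_max_left _ _) (Finset.mem_univ i)
  have h2 := (le_max_right 0 (x.1 i - (f x).1 i)).trans (h1.trans hx0)
  linarith

end Brouwer

/-! ### Compact convex sets and finitely many functionals -/

section Convex

variable {X : Type*} [AddCommGroup X] [Module ℝ X] [TopologicalSpace X]
  [IsTopologicalAddGroup X] [ContinuousSMul ℝ X] {C : Set X} {f : C → C}

theorem IsCompact.exists_approx_fixedPoint (hne : C.Nonempty) (hcpt : IsCompact C)
    (hconv : Convex ℝ C) (hf : Continuous f) (F : Finset (StrongDual ℝ X)) {ε : ℝ} (hε : 0 < ε) :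
    ∃ x : C, ∑ h ∈ F, |h (f x) - h x| ≤ ε := by
  classical
  have : CompactSpace C := isCompact_iff_compactSpace.1 hcpt
  have hval : ∀ h : StrongDual ℝ X, Continuous fun x : C => h x := fun h =>
    h.continuous.comp continuous_subtype_val
  set d : C → C → ℝ := fun c x => ∑ h ∈ F, |h x - h c| with hd
  have hdc : ∀ c, Continuous (d c) := fun c =>
    continuous_finsetSum _ fun h _ => ((hval h).sub continuous_const).abs
  obtain ⟨t, ht⟩ := isCompact_univ.elim_finite_subcover (fun c : C => {x | d c x < ε})
    (fun c => isOpen_lt (hdc c) continuous_const)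
    (fun x _ => Set.mem_iUnion.2 ⟨x, by simpa [hd] using hε⟩)
  have hcover : ∀ x, ∃ c ∈ t, d c x < ε := fun x => by simpa using ht (Set.mem_univ x)
  obtain ⟨x₀, hx₀⟩ := hne
  have htne : Nonempty t := by
    obtain ⟨c, hc, -⟩ := hcover ⟨x₀, hx₀⟩
    exact ⟨⟨c, hc⟩⟩
  set φ : t → C → ℝ := fun c x => max 0 (ε - d c x) with hφ
  have hφ0 : ∀ c x, 0 ≤ φ c x := fun c x => le_max_left _ _
  have hφc : ∀ c, Continuous (φ c) := fun c => continuous_const.max (continuous_const.sub (hdc c))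
  have hpos : ∀ x, 0 < ∑ c, φ c x := fun x => by
    obtain ⟨c, hc, hcx⟩ := hcover x
    exact Finset.sum_pos' (fun c _ => hφ0 c x)
      ⟨⟨c, hc⟩, Finset.mem_univ _, lt_max_of_lt_right (sub_pos.2 hcx)⟩
  let P : C → stdSimplex ℝ t := fun x => ⟨fun c => φ c x / ∑ c, φ c x,
    fun c => div_nonneg (hφ0 c x) (hpos x).le, by rw [← Finset.sum_div, div_self (hpos x).ne']⟩
  have hPc : Continuous P := Continuous.subtype_mk (continuous_pi fun c =>
    (hφc c).div (continuous_finsetSum _ fun c _ => hφc c) fun x => (hpos x).ne') _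
  let σ : stdSimplex ℝ t → C := fun w => ⟨∑ c, w.1 c • (c.1 : X),
    hconv.sum_mem (fun c _ => w.2.1 c) w.2.2 fun c _ => c.1.2⟩
  have hσc : Continuous σ := Continuous.subtype_mk (continuous_finsetSum _ fun c _ =>
    ((continuous_apply c).comp continuous_subtype_val).smul continuous_const) _
  -- Composing in this order keeps the fixed point on the simplex. A weight `w c` is positive only
  -- if `f (σ w)` is `ε`-close to `c`, and `σ w` is the average of these `c`.
  obtain ⟨w, hw⟩ := stdSimplex.exists_fixedPoint (hPc.comp (hf.comp hσc))
  have hwd : ∀ c, w.1 c * d c (f (σ w)) ≤ w.1 c * ε := fun c => by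
    rcases (w.2.1 c).eq_or_lt with h | h
    · rw [← h, zero_mul, zero_mul]
    · refine mul_le_mul_of_nonneg_left ?_ h.le
      by_contra! hlt
      have hz : φ c (f (σ w)) = 0 := max_eq_left (by linarith)
      have : (P (f (σ w))).1 c = w.1 c := congrArg (fun v : stdSimplex ℝ t => v.1 c) hw
      rw [← this] at h
      simp [P, hz] at h
  refine ⟨σ w, ?_⟩
  calc ∑ h ∈ F, |h (f (σ w)) - h (σ w)|
      ≤ ∑ h ∈ F, ∑ c, w.1 c * |h (f (σ w)) - h c.1| := Finset.sum_le_sum fun h _ => by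
        have : h (f (σ w)) - h (σ w) = ∑ c, w.1 c * (h (f (σ w)) - h c.1) := by
          simp only [mul_sub, Finset.sum_sub_distrib, ← Finset.sum_mul, w.2.2, one_mul, σ,
            map_sum, map_smul, smul_eq_mul]
        rw [this]
        refine (Finset.abs_sum_le_sum_abs _ _).trans (Finset.sum_le_sum fun c _ => ?_)
        rw [abs_mul, abs_of_nonneg (w.2.1 c)]
    _ = ∑ c, w.1 c * d c (f (σ w)) := by
        rw [Finset.sum_comm]
        simp only [hd, Finset.mul_sum]
    _ ≤ ∑ c, w.1 c * ε := Finset.sum_le_sum fun c _ => hwd c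
    _ = ε := by rw [← Finset.sum_mul, w.2.2, one_mul]

theorem IsCompact.exists_forall_mem_map_eq (hne : C.Nonempty) (hcpt : IsCompact C)
    (hconv : Convex ℝ C) (hf : Continuous f) (F : Finset (StrongDual ℝ X)) :
    ∃ x : C, ∀ h ∈ F, h (f x) = h x := by
  have : CompactSpace C := isCompact_iff_compactSpace.1 hcpt
  have : Nonempty C := hne.to_subtype
  have hval : ∀ h : StrongDual ℝ X, Continuous fun x : C => h x := fun h =>
    h.continuous.comp continuous_subtype_val
  have hc : Continuous fun x : C => ∑ h ∈ F, |h (f x) - h x| :=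
    continuous_finsetSum _ fun h _ => (((hval h).comp hf).sub (hval h)).abs
  obtain ⟨x, -, hx⟩ := isCompact_univ.exists_isMinOn Set.univ_nonempty hc.continuousOn
  have hx0 : ∑ h ∈ F, |h (f x) - h x| ≤ 0 := le_of_forall_pos_le_add fun ε hε => by
    obtain ⟨y, hy⟩ := hcpt.exists_approx_fixedPoint hne hconv hf F hε
    rw [zero_add]
    exact (hx (Set.mem_univ y)).trans hy
  refine ⟨x, fun h hh => sub_eq_zero.1 (abs_nonpos_iff.1 ?_)⟩
  exact (Finset.single_le_sum (f := fun h : StrongDual ℝ X => |h (f x) - h x|)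
    (fun _ _ => abs_nonneg _) hh).trans hx0

end Convex

/-! ### The fixed point theorem -/

theorem theorem4p3 {X : Type*} [AddCommGroup X] [Module ℝ X] [TopologicalSpace X]
    [IsTopologicalAddGroup X] [ContinuousSMul ℝ X]
    (hX : ∀ x : X, (∀ h : StrongDual ℝ X, h x = 0) → x = 0)
    (C : Set X) (hne : C.Nonempty) (hcpt : IsCompact C) (hconv : Convex ℝ C)
    (f : C → C) (hf : Continuous f) :
    ∃ x : C, f x = x := by
  have : CompactSpace C := isCompact_iff_compactSpace.1 hcpt
  have hval : ∀ h : StrongDual ℝ X, Continuous fun x : C => h x := fun h =>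
    h.continuous.comp continuous_subtype_val
  obtain ⟨x, -, hx⟩ := isCompact_univ.inter_iInter_nonempty
    (fun h : StrongDual ℝ X => {x : C | h (f x) = h x})
    (fun h => isClosed_eq ((hval h).comp hf) (hval h)) fun F => by
      obtain ⟨x, hx⟩ := hcpt.exists_forall_mem_map_eq hne hconv hf F
      exact ⟨x, Set.mem_univ _, Set.mem_iInter₂.2 hx⟩
  refine ⟨x, Subtype.ext (sub_eq_zero.1 (hX _ fun h => ?_))⟩
  rw [map_sub, sub_eq_zero]
  exact Set.mem_iInter.1 hx h
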